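/- Let $0\le m\le n$ be integers. Let $\mathrm{PF}(m,n)$ be the set of parking functions of $m$ cars on a one-way street with spots $1,\dots,n$: lists $\pi=(\pi_1,\dots,\pi_m)\in\{1,\dots,n\}^m$ such that, when cars $1,\dots,m$ arrive in this order and car $i$ parks in the first unoccupied spot $\ge \pi_i$, all cars park. Write $\#k(\pi)=\#\{i:\pi_i=k\}$. Let $\mathcal F(m,n)$ be the set of rooted forests with roots $01,02,\dots,0(n-m+1)$ (one in each tree) and non-root vertices $1,\dots,m$; such a forest $F$ is given by its acyclic function $f$, where $f_i$ is the parent of the non-root vertex $i$. The degree of a vertex is its number of children. Read the vertices $v_1,\dots,v_{n+1}$ of $F\in\mathcal F(m,n)$ in breadth first search order: the roots $01,\dots,0(n-m+1)$ first, then the vertices at distance $1$ from a root, then those at distance $2$, and so on, where vertices of the same level are ordered by the place of their parents in this order, and those with the same parent by increasing label. Let $t(f)=(r_1,\dots,r_n)$, where $r_k$ is the degree of $v_k$, and let $\sigma_f(i)\in\{1,\dots,m\}$ be the place of vertex $i$ among the non-root vertices in this order. Define $\phi(F)=\pi$ by letting $\pi_i$ be the $\sigma_f(i)$-th term of the non-decreasing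 sequence $1^{r_1}2^{r_2}\cdots n^{r_n}$. **Theorem.** The map $\phi$ is a bijection from $\mathcal F(m,n)$ onto $\mathrm{PF}(m,n)$. If $\pi=\phi(F)$, then $(\#1(\pi),\dots,\#n(\pi))=t(f)$ and $\#\{j:\pi_j<\pi_i,\text{ or }\pi_j=\pi_i\text{ and }j\le i\}=\sigma_f(i)$ for all $i$, and moreover: 1. for every $i\in\{1,\dots,m\}$, the number of times $\pi_i$ appears in $\pi$ equals the degree of the parent of vertex $i$ in $F$; 2. for every $j\in\{1,\dots,n-m+1\}$, the number of times $j$ appears in $\pi$ equals the degree of the root $0j$ in $F$. Consequently the two families of statistics are jointly equidistributed: for every set $A\subseteq\mathbb N^m\times\mathbb N^{n-m+1}$, the number of $\pi\in\mathrm{PF}(m,n)$ with $\big((\#\pi_i(\pi))_{1\le i\le m},(\#j(\pi))_{1\le j\le n-m+1}\big)\in A$ equals the number of $F\in\mathcal F(m,n)$ with $\big((\deg f_i)_{1\le i\le m},(\deg 0j)_{1\le j\le n-m+1}\big)\in A$. -/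

import Mathlib

/-! ## Parking functions with `m` cars and `n` spots

Cars are indexed by `Fin m` (the element `i` is the car, or the vertex, labelled `i + 1`);
the parking spots are the natural numbers `1, …, n`. -/

/-- `ParksAt pref spot`: the cars arrive in order, and car `i` parks in the first spot from its
preferred spot `pref i` on that is not occupied by an earlier car; `spot i` is that spot
(on a street that is unbounded to the right). -/
def ParksAt {m : ℕ} (pref spot : Fin m → ℕ) : Prop :=
  ∀ i, IsLeast {s : ℕ | pref i ≤ s ∧ ∀ j, j < i → spot j ≠ s} (spot i)

/-- `PF(m, n)`: the preference lists in `{1, …, n}^m` for which all cars park in `1, …, n`. -/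
def ParkingFunctions (m n : ℕ) : Set (Fin m → ℕ) :=
  {pref | (∀ i, 1 ≤ pref i ∧ pref i ≤ n) ∧
    ∃ spot : Fin m → ℕ, ParksAt pref spot ∧ ∀ i, spot i ≤ n}

/-- `#k(π)`, the number of cars that prefer spot `k`. -/
def prefCount {m : ℕ} (pref : Fin m → ℕ) (k : ℕ) : ℕ :=
  (Finset.univ.filter fun i => pref i = k).card

/-- The specification `s(π) = (#1(π), …, #n(π))`. -/
def parkingSpec {m : ℕ} (n : ℕ) (pref : Fin m → ℕ) : List ℕ :=
  (List.range n).map fun k => prefCount pref (k + 1)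

/-- The order permutation `τ_π(i) = #{j : π_j < π_i, or π_j = π_i and j ≤ i}`, with values
in `{1, …, m}`. -/
def orderPerm {m : ℕ} (pref : Fin m → ℕ) (i : Fin m) : ℕ :=
  (Finset.univ.filter fun j => pref j < pref i ∨ (pref j = pref i ∧ j ≤ i)).card

/-! ## Rooted forests -/

/-- The `n + 1` vertices (for `m ≤ n`): `Sum.inl j` is the root labelled `0(j+1)`, and
`Sum.inr i` is the non-root vertex labelled `i + 1`. -/
abbrev ForestVertex (m n : ℕ) : Type := Fin (n - m + 1) ⊕ Fin m

/-- `F(m, n)`: rooted forests with roots `01, …, 0(n-m+1)` and non-root vertices `1, …, m`.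
A forest is given by its acyclic function, which sends each non-root vertex to its parent;
acyclicity says that going from vertex to parent repeatedly never returns to the start. -/
@[ext]
structure RootedForest (m n : ℕ) where
  /-- the parent of a non-root vertex -/
  parent : Fin m → ForestVertex m n
  acyclic : ∀ i, ¬ Relation.TransGen (fun a b => parent a = Sum.inr b) i i

namespace RootedForest

variable {m n : ℕ}

/-- The children of `v`, in increasing order of their labels. -/
def children (F : RootedForest m n) (v : ForestVertex m n) : List (ForestVertex m n) :=
  ((List.finRange m).filter fun i => F.parent i = v).map Sum.inr

/-- The degree of `v`, that is, its number of children. -/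
def deg (F : RootedForest m n) (v : ForestVertex m n) : ℕ :=
  (Finset.univ.filter fun i => F.parent i = v).card

/-- The vertices at distance `k` from the roots: the roots in order for `k = 0`; each further
level is ordered by the place of the predecessor in the previous level, and vertices with the
same predecessor are ordered by their labels. -/
def level (F : RootedForest m n) : ℕ → List (ForestVertex m n)
  | 0 => (List.finRange (n - m + 1)).map Sum.inl
  | k + 1 => (F.level k).flatMap F.children

/-- The vertices `v₁, v₂, …` in breadth first search order (levels beyond `m` are empty). -/
def bfsOrder (F : RootedForest m n) : List (ForestVertex m n) :=
  (List.range (m + 1)).flatMap F.level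

/-- The specification `t(f)`: the degrees of `v₁, …, vₙ`. -/
def spec (F : RootedForest m n) : List ℕ :=
  (F.bfsOrder.take n).map F.deg

/-- The sequence `σ_f⁻¹`: the non-root vertices in breadth first search order. -/
def nonrootOrder (F : RootedForest m n) : List (Fin m) :=
  F.bfsOrder.filterMap Sum.getRight?

/-- `σ_f(i)`: the place, in `{1, …, m}`, of the vertex `i` in `nonrootOrder`. -/
def bfsPerm (F : RootedForest m n) (i : Fin m) : ℕ :=
  F.nonrootOrder.idxOf i + 1

end RootedForest

/-- The non-decreasing sequence `1^{r₁} 2^{r₂} ⋯` attached to `(r₁, r₂, …)`. -/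
def nondecreasingOfSpec (s : List ℕ) : List ℕ :=
  (List.range s.length).flatMap fun k => List.replicate (s.getD k 0) (k + 1)

/-- The breadth first search map `φ`: its `i`-th entry is the `σ_f(i)`-th term of the
non-decreasing sequence attached to `t(f)`. -/
def bfsMap {m n : ℕ} (F : RootedForest m n) : Fin m → ℕ :=
  fun i => (nondecreasingOfSpec F.spec).getD (F.bfsPerm i - 1) 0

/-! ## The statistics -/

/-- The numbers of occurrences of `π_1, …, π_m`, and those of `1, …, n-m+1`, in `π`. -/
def parkingStat {m : ℕ} (n : ℕ) (pref : Fin m → ℕ) : (Fin m → ℕ) × (Fin (n - m + 1) → ℕ) :=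
  (fun i => prefCount pref (pref i), fun j => prefCount pref ((j : ℕ) + 1))

/-- The degrees of the parents of `1, …, m`, and those of the roots `01, …, 0(n-m+1)`. -/
def forestStat {m n : ℕ} (F : RootedForest m n) : (Fin m → ℕ) × (Fin (n - m + 1) → ℕ) :=
  (fun i => F.deg (F.parent i), fun j => F.deg (Sum.inl j))

/-! After the roots, the breadth first order lists the children of v₁, then those of v₂, and so on.
So the term of 1^{r₁} 2^{r₂} ⋯ with index σ_f(i) is the place of the parent of i
(`RootedForest.bfsMap_apply`). Hence #k(π) is the degree of v_k, and both statistics follow, since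
0j is v_j.

Sorting the labels by (π_i, i) recovers the breadth first order from π, and π_i then points to the
parent: φ is injective. For surjectivity, write the sorted labels after the roots and let the parent
of i be the π_i-th entry. The counting criterion for parking functions (`mem_parkingFunctions_iff`)
makes every parent precede its children, so this is a forest. The list consists of the roots
followed by the children of its own members, and with n + 1 entries this forces it to be the breadth
first order (`RootedForest.eq_bfsOrder`). -/

instance Sum.lawfulBEq {α β : Type*} [BEq α] [BEq β] [LawfulBEq α] [LawfulBEq β] :
    LawfulBEq (α ⊕ β) where
  eq_of_beq {a b} h := by
    rcases a with a | a <;> rcases b with b | b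
    · exact congrArg Sum.inl (eq_of_beq (a := a) h)
    · exact absurd h Bool.false_ne_true
    · exact absurd h Bool.false_ne_true
    · exact congrArg Sum.inr (eq_of_beq (a := a) h)
  rfl {a} := by
    rcases a with a | a
    · exact beq_self_eq_true a
    · exact beq_self_eq_true a

/-! ### Breadth first order and the formula for `φ` -/

namespace RootedForest

variable {m n : ℕ} (F : RootedForest m n)

/-- The labels of the children of `v`, in increasing order. -/
def childLabels (v : ForestVertex m n) : List (Fin m) :=
  (List.finRange m).filter fun i => F.parent i = v

/-- The place, counted from `0`, of `v` in the breadth first search order. -/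
def place (v : ForestVertex m n) : ℕ :=
  F.bfsOrder.idxOf v

theorem children_eq_map (v : ForestVertex m n) :
    F.children v = (F.childLabels v).map Sum.inr := rfl

@[simp]
theorem mem_childLabels {v : ForestVertex m n} {i : Fin m} :
    i ∈ F.childLabels v ↔ F.parent i = v := by
  simp [childLabels]

@[simp]
theorem inr_mem_children {v : ForestVertex m n} {i : Fin m} :
    Sum.inr i ∈ F.children v ↔ F.parent i = v := by
  simp [children_eq_map]

theorem inl_notMem_children {v : ForestVertex m n} {j : Fin (n - m + 1)} :
    Sum.inl j ∉ F.children v := by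
  simp [children_eq_map]

theorem pairwise_childLabels (v : ForestVertex m n) :
    (F.childLabels v).Pairwise (· < ·) :=
  (List.pairwise_lt_finRange m).filter _

theorem length_childLabels (v : ForestVertex m n) : (F.childLabels v).length = F.deg v := by
  have hnd : (F.childLabels v).Nodup := (List.nodup_finRange m).filter _
  rw [← List.toFinset_card_of_nodup hnd, deg]
  congr 1
  ext i
  simp

theorem nodup_children (v : ForestVertex m n) : (F.children v).Nodup :=
  ((List.nodup_finRange m).filter _).map Sum.inr_injective

theorem inr_mem_level_succ {k : ℕ} {i : Fin m} :
    Sum.inr i ∈ F.level (k + 1) ↔ F.parent i ∈ F.level k := by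
  simp [level]

theorem inr_notMem_level_zero {i : Fin m} : Sum.inr i ∉ F.level 0 := by
  simp [level]

theorem inl_mem_level {k : ℕ} {j : Fin (n - m + 1)} : Sum.inl j ∈ F.level k ↔ k = 0 := by
  cases k with
  | zero => simp [level]
  | succ k => simp [level, inl_notMem_children]

theorem eq_of_mem_level {j k : ℕ} {v : ForestVertex m n} (hj : v ∈ F.level j)
    (hk : v ∈ F.level k) : j = k := by
  induction j generalizing k v with
  | zero =>
    rcases v with v | v
    · exact ((F.inl_mem_level).1 hk).symm
    · exact absurd hj F.inr_notMem_level_zero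
  | succ j ih =>
    rcases v with v | v
    · exact absurd ((F.inl_mem_level).1 hj) (by omega)
    · cases k with
      | zero => exact absurd hk F.inr_notMem_level_zero
      | succ k => rw [ih (F.inr_mem_level_succ.1 hj) (F.inr_mem_level_succ.1 hk)]

theorem nodup_level (k : ℕ) : (F.level k).Nodup := by
  induction k with
  | zero => exact (List.nodup_finRange _).map Sum.inl_injective
  | succ k ih =>
    rw [level, List.nodup_flatMap]
    refine ⟨fun v _ => F.nodup_children v, ih.imp ?_⟩
    rintro v w hvw (x | x) hv hw
    · exact F.inl_notMem_children hv
    · exact hvw ((F.inr_mem_children.1 hv).symm.trans (F.inr_mem_children.1 hw))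

/-- On a finite set acyclicity makes the parent relation well founded, so induction from parent to
child applies. -/
theorem exists_mem_level (v : ForestVertex m n) : ∃ k, v ∈ F.level k := by
  rcases v with j | i
  · exact ⟨0, F.inl_mem_level.2 rfl⟩
  · let r : Fin m → Fin m → Prop := Relation.TransGen fun a b => F.parent b = Sum.inr a
    have hr : ∀ a b, r a b → Relation.TransGen (fun a b => F.parent a = Sum.inr b) b a :=
      fun a b h => Relation.transGen_swap.1 h
    have : Std.Irrefl r := ⟨fun a h => F.acyclic a (hr a a h)⟩
    have : IsTrans (Fin m) r := ⟨fun _ _ _ => Relation.TransGen.trans⟩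
    have wf : WellFounded r := Finite.wellFounded_of_trans_of_irrefl r
    induction i using wf.induction with
    | _ i ih =>
      rcases h : F.parent i with j | a
      · exact ⟨1, F.inr_mem_level_succ.2 (h ▸ F.inl_mem_level.2 rfl)⟩
      · obtain ⟨k, hk⟩ := ih a (Relation.TransGen.single h)
        exact ⟨k + 1, F.inr_mem_level_succ.2 (h ▸ hk)⟩

theorem level_ne_nil_of_le {j k : ℕ} (hjk : j ≤ k) (hk : F.level k ≠ []) : F.level j ≠ [] := by
  induction k, hjk using Nat.le_induction with
  | base => exact hk
  | succ k _ ih =>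
    refine ih fun h => hk ?_
    rw [level, h, List.flatMap_nil]

/-- Otherwise levels 1, …, m + 1 would all be nonempty; being disjoint, they would contain m + 1
distinct labels. -/
theorem level_eq_nil {k : ℕ} (hk : m < k) : F.level k = [] := by
  by_contra h
  have hex : ∀ j : Fin (m + 1), ∃ i : Fin m, Sum.inr i ∈ F.level (j + 1) := by
    intro j
    obtain ⟨v, hv⟩ := List.exists_mem_of_ne_nil _
      (F.level_ne_nil_of_le (show (j : ℕ) + 1 ≤ k by omega) h)
    rcases v with v | i
    · exact absurd (F.inl_mem_level.1 hv) (by omega)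
    · exact ⟨i, hv⟩
  choose g hg using hex
  have hinj : Function.Injective g := fun a b hab => by
    have := F.eq_of_mem_level (hg a) (hab ▸ hg b)
    exact Fin.ext (by omega)
  simpa using Fintype.card_le_of_injective g hinj

theorem mem_bfsOrder (v : ForestVertex m n) : v ∈ F.bfsOrder := by
  obtain ⟨k, hk⟩ := F.exists_mem_level v
  refine List.mem_flatMap.2 ⟨k, List.mem_range.2 ?_, hk⟩
  by_contra h
  rw [F.level_eq_nil (by omega)] at hk
  exact List.not_mem_nil hk

theorem nodup_bfsOrder : F.bfsOrder.Nodup := by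
  rw [bfsOrder, List.nodup_flatMap]
  exact ⟨fun k _ => F.nodup_level k,
    List.nodup_range.imp fun h v hj hk => h (F.eq_of_mem_level hj hk)⟩

theorem length_bfsOrder (hmn : m ≤ n) : F.bfsOrder.length = n + 1 := by
  rw [← List.toFinset_card_of_nodup F.nodup_bfsOrder,
    Finset.eq_univ_iff_forall.2 fun v => List.mem_toFinset.2 (F.mem_bfsOrder v),
    Finset.card_univ, Fintype.card_sum, Fintype.card_fin, Fintype.card_fin]
  omega

/-- Unfolding a list that consists of the roots and the children of its own members. -/
theorem eq_levels_append {L : List (ForestVertex m n)}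
    (hL : L = F.level 0 ++ L.flatMap F.children) (k : ℕ) :
    ∃ R, L = (List.range k).flatMap F.level ++ R := by
  suffices h : ∀ k, ∃ R, L = (List.range (k + 1)).flatMap F.level ++ R ∧
      L.flatMap F.children = (List.range k).flatMap (fun j => F.level (j + 1)) ++ R by
    cases k with
    | zero => exact ⟨L, by simp⟩
    | succ k => exact (h k).imp fun R hR => hR.1
  intro k
  induction k with
  | zero => exact ⟨L.flatMap F.children, by simpa using hL, by simp⟩
  | succ k ih =>
    obtain ⟨R, h₁, -⟩ := ih
    -- Taking children moves each level to the next one.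
    have h₂ : L.flatMap F.children =
        (List.range (k + 1)).flatMap (fun j => F.level (j + 1)) ++ R.flatMap F.children := by
      conv_lhs => rw [h₁]
      rw [List.flatMap_append, List.flatMap_assoc]
      rfl
    refine ⟨R.flatMap F.children, ?_, h₂⟩
    conv_lhs => rw [hL, h₂]
    rw [← List.append_assoc]
    congr 1
    rw [List.range_succ_eq_map (n := k + 1), List.flatMap_cons, List.flatMap_map]

theorem bfsOrder_eq_append_flatMap :
    F.bfsOrder = F.level 0 ++ F.bfsOrder.flatMap F.children := by
  have h : F.bfsOrder = (List.range (m + 2)).flatMap F.level := by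
    rw [List.range_succ, List.flatMap_append, List.flatMap_singleton,
      F.level_eq_nil (Nat.lt_succ_self m), List.append_nil, bfsOrder]
  conv_lhs => rw [h, List.range_succ_eq_map, List.flatMap_cons, List.flatMap_map]
  rw [bfsOrder, List.flatMap_assoc]
  rfl

/-- Such a list starts with levels 0, …, m, and its length leaves no room for a remainder. -/
theorem eq_bfsOrder (hmn : m ≤ n) {L : List (ForestVertex m n)}
    (hL : L = F.level 0 ++ L.flatMap F.children) (hlen : L.length = n + 1) :
    L = F.bfsOrder := by
  obtain ⟨R, hR⟩ := F.eq_levels_append hL (m + 1)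
  have h := congrArg List.length hR
  rw [List.length_append, hlen, ← bfsOrder, F.length_bfsOrder hmn] at h
  rw [hR, List.eq_nil_of_length_eq_zero (show R.length = 0 by omega), List.append_nil, bfsOrder]

theorem flatMap_children_eq_map (L : List (ForestVertex m n)) :
    L.flatMap F.children = (L.flatMap F.childLabels).map Sum.inr := by
  rw [List.map_flatMap]
  rfl

theorem nonrootOrder_eq_flatMap : F.nonrootOrder = F.bfsOrder.flatMap F.childLabels := by
  rw [nonrootOrder]
  conv_lhs => rw [bfsOrder_eq_append_flatMap, flatMap_children_eq_map]
  simp [level, List.filterMap_map, Function.comp_def]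

theorem bfsOrder_eq_append_map :
    F.bfsOrder = (List.finRange (n - m + 1)).map Sum.inl ++ F.nonrootOrder.map Sum.inr := by
  rw [nonrootOrder_eq_flatMap, ← flatMap_children_eq_map]
  exact F.bfsOrder_eq_append_flatMap

theorem mem_nonrootOrder (i : Fin m) : i ∈ F.nonrootOrder := by
  rw [nonrootOrder_eq_flatMap]
  exact List.mem_flatMap.2 ⟨_, F.mem_bfsOrder _, F.mem_childLabels.2 rfl⟩

theorem place_injective : Function.Injective F.place := fun v _ h =>
  (List.idxOf_inj (F.mem_bfsOrder v)).1 h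

theorem place_lt (hmn : m ≤ n) (v : ForestVertex m n) : F.place v < n + 1 := by
  rw [← F.length_bfsOrder hmn]
  exact List.idxOf_lt_length_of_mem (F.mem_bfsOrder v)

theorem place_getElem {k : ℕ} (hk : k < F.bfsOrder.length) : F.place F.bfsOrder[k] = k :=
  F.nodup_bfsOrder.idxOf_getElem k hk

theorem place_inl (j : Fin (n - m + 1)) : F.place (Sum.inl j) = j := by
  have h := F.bfsOrder_eq_append_map
  have hj : (j : ℕ) < F.bfsOrder.length := by
    have := j.2
    rw [h, List.length_append, List.length_map, List.length_finRange]
    omega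
  have : F.bfsOrder[(j : ℕ)] = Sum.inl j := by
    simp only [h]
    rw [List.getElem_append_left (by simpa using Nat.le_of_lt_succ j.2)]
    simp
  rw [← this, place_getElem]

theorem place_parent_lt (i : Fin m) : F.place (F.parent i) < F.place (Sum.inr i) := by
  obtain ⟨k, hk⟩ := F.exists_mem_level (F.parent i)
  have hi := F.inr_mem_level_succ.2 hk
  have hkm : k + 1 ≤ m := by
    by_contra h
    rw [F.level_eq_nil (by omega)] at hi
    exact List.not_mem_nil hi
  -- Cut the order just after the level of the parent.
  have hsplit : F.bfsOrder = (List.range (k + 1)).flatMap F.level ++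
      ((List.range (m - k)).map (k + 1 + ·)).flatMap F.level := by
    rw [← List.flatMap_append, ← List.range_add, bfsOrder]
    congr 2; omega
  have h₁ : F.parent i ∈ (List.range (k + 1)).flatMap F.level :=
    List.mem_flatMap.2 ⟨k, by simp, hk⟩
  have h₂ : Sum.inr i ∉ (List.range (k + 1)).flatMap F.level := by
    intro h
    obtain ⟨j, hj, hij⟩ := List.mem_flatMap.1 h
    have := F.eq_of_mem_level hi hij
    have := List.mem_range.1 hj
    omega
  rw [place, place, hsplit, List.idxOf_append_of_mem h₁, List.idxOf_append_of_notMem h₂]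
  exact Nat.lt_add_right _ (List.idxOf_lt_length_of_mem h₁)

theorem place_parent_lt_n (hmn : m ≤ n) (i : Fin m) : F.place (F.parent i) < n := by
  have := F.place_parent_lt i
  have := F.place_lt hmn (Sum.inr i)
  omega

theorem deg_eq_card_place (v : ForestVertex m n) :
    F.deg v = (Finset.univ.filter fun i => F.place (F.parent i) = F.place v).card := by
  simp only [deg, F.place_injective.eq_iff]

/-- The last vertex v_{n+1} has no children, as they would come after it; so `spec` loses nothing by
omitting its degree. -/
theorem flatMap_take_bfsOrder (hmn : m ≤ n) :
    F.nonrootOrder = (F.bfsOrder.take n).flatMap F.childLabels := by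
  have hd : (F.bfsOrder.drop n).flatMap F.childLabels = [] := by
    rw [List.flatMap_eq_nil_iff]
    intro v hv
    rw [List.eq_nil_iff_forall_not_mem]
    intro i hi
    rw [mem_childLabels] at hi
    obtain ⟨k, hk, rfl⟩ := List.mem_drop_iff_getElem.1 hv
    have := F.place_parent_lt_n hmn i
    rw [hi, place_getElem] at this
    omega
  rw [nonrootOrder_eq_flatMap]
  conv_lhs => rw [← List.take_append_drop n F.bfsOrder]
  rw [List.flatMap_append, hd, List.append_nil]

/-- Both sides split into one block per vertex v_k, whose length is the number of children of v_k.
-/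
theorem nondecreasingOfSpec_spec (hmn : m ≤ n) :
    nondecreasingOfSpec F.spec = F.nonrootOrder.map fun i => F.place (F.parent i) + 1 := by
  have hlen : F.spec.length = n := by
    simp [spec, F.length_bfsOrder hmn]
  have htake : F.bfsOrder.take n = (List.range n).map fun k => F.bfsOrder.getD k (Sum.inl 0) := by
    apply List.ext_getElem
    · simp [F.length_bfsOrder hmn]
    · intro k h₁ h₂
      simp at h₁
      simp [List.getD_eq_getElem?_getD, List.getElem?_eq_getElem h₁.2]
  rw [nondecreasingOfSpec, hlen, F.flatMap_take_bfsOrder hmn, List.map_flatMap, htake,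
    List.flatMap_map]
  refine List.flatMap_congr fun k hk => ?_
  rw [List.mem_range] at hk
  have hk' : k < F.bfsOrder.length := by rw [F.length_bfsOrder hmn]; omega
  have hget : F.bfsOrder.getD k (Sum.inl 0) = F.bfsOrder[k] := by
    simp [List.getD_eq_getElem?_getD, List.getElem?_eq_getElem hk']
  have hdeg : F.spec.getD k 0 = F.deg F.bfsOrder[k] := by
    rw [List.getD_eq_getElem _ _ (by omega)]
    simp [spec]
  rw [hget, hdeg, eq_comm, List.eq_replicate_iff]
  refine ⟨by rw [List.length_map, length_childLabels], fun b hb => ?_⟩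
  obtain ⟨i, hi, rfl⟩ := List.mem_map.1 hb
  rw [(F.mem_childLabels).1 hi, place_getElem]

theorem bfsMap_apply (hmn : m ≤ n) (i : Fin m) : bfsMap F i = F.place (F.parent i) + 1 := by
  have hi := List.idxOf_lt_length_of_mem (F.mem_nonrootOrder i)
  rw [bfsMap, F.nondecreasingOfSpec_spec hmn, bfsPerm, Nat.add_sub_cancel,
    List.getD_eq_getElem _ _ (by simpa using hi), List.getElem_map, List.getElem_idxOf]

theorem prefCount_bfsMap (hmn : m ≤ n) (v : ForestVertex m n) :
    prefCount (bfsMap F) (F.place v + 1) = F.deg v := by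
  simp only [prefCount, F.bfsMap_apply hmn, deg_eq_card_place, Nat.add_right_cancel_iff]

theorem parkingSpec_bfsMap (hmn : m ≤ n) : parkingSpec n (bfsMap F) = F.spec := by
  apply List.ext_getElem
  · simp [parkingSpec, spec, F.length_bfsOrder hmn]
  · intro k h₁ h₂
    have hk : k < F.bfsOrder.length := by
      simp [parkingSpec] at h₁
      rw [F.length_bfsOrder hmn]; omega
    have := F.prefCount_bfsMap hmn F.bfsOrder[k]
    rw [place_getElem] at this
    simpa [parkingSpec, spec] using this

end RootedForest

/-! ### The counting criterion for parking functions -/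

/-- Every preference list parks all cars on a street that is unbounded to the right. -/
theorem exists_parksAt {m : ℕ} (pref : Fin m → ℕ) : ∃ spot, ParksAt pref spot := by
  have hne : ∀ (i : Fin m) (g : ∀ j : Fin m, j < i → ℕ),
      ∃ s, pref i ≤ s ∧ ∀ (j : Fin m) (h : j < i), g j h ≠ s := by
    intro i g
    obtain ⟨s, hs, hs'⟩ := (Set.finite_range fun j : {j // j < i} => g j j.2).infinite_compl.exists_gt
      (pref i)
    exact ⟨s, hs'.le, fun j h e => hs ⟨⟨j, h⟩, e⟩⟩
  classical
  let spot : Fin m → ℕ := (wellFounded_lt (α := Fin m)).fix fun i g => Nat.find (hne i g)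
  have hspot : ∀ i, spot i = Nat.find (hne i fun j _ => spot j) := fun i =>
    WellFounded.fix_eq _ _ i
  refine ⟨spot, fun i => ?_⟩
  rw [hspot i]
  exact ⟨Nat.find_spec (hne i fun j _ => spot j), fun s hs => Nat.find_min' _ hs⟩

theorem ParksAt.injective {m : ℕ} {pref spot : Fin m → ℕ} (h : ParksAt pref spot) :
    Function.Injective spot := by
  intro i j hij
  rcases lt_trichotomy i j with hlt | heq | hlt
  · exact absurd hij ((h j).1.2 i hlt)
  · exact heq
  · exact absurd hij.symm ((h i).1.2 j hlt)

/-- If all the spots are at most `n`, then at most `n - k` cars prefer a spot beyond `k`. -/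
theorem ParksAt.card_lt_pref_le {m n : ℕ} {pref spot : Fin m → ℕ} (h : ParksAt pref spot)
    (hn : ∀ i, spot i ≤ n) (k : ℕ) : (Finset.univ.filter fun i => k < pref i).card ≤ n - k := by
  rw [← Nat.card_Ioc]
  refine Finset.card_le_card_of_injOn spot (fun i hi => ?_) h.injective.injOn
  have := (h i).1.1
  simp at hi ⊢
  exact ⟨by omega, hn i⟩

/-- If some car parks beyond `n`, then for some `k ≤ n` more than `n - k` cars prefer a spot
beyond `k`. -/
theorem ParksAt.exists_lt_card {m n : ℕ} {pref spot : Fin m → ℕ} (h : ParksAt pref spot)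
    (hpref : ∀ i, 1 ≤ pref i ∧ pref i ≤ n) {i : Fin m} (hi : n < spot i) :
    ∃ k ≤ n, n - k < (Finset.univ.filter fun i => k < pref i).card := by
  classical
  -- Car i drove past every spot up to n; if it parks at n + 1, it fills that spot itself.
  have hfull : ∀ s, pref i ≤ s → s ≤ n + 1 → ∃ j, spot j = s := by
    intro s hs hsn
    by_contra! hc
    have := (h i).2 ⟨hs, fun j _ => hc j⟩
    exact hc i (by omega)
  -- Spot 0 stays free, as preferences start at 1.
  have hfree : ∃ k, k ≤ n ∧ ∀ j, spot j ≠ k := ⟨0, by omega, fun j hj => by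
    have := (h j).1.1
    have := hpref j
    omega⟩
  -- The last free spot up to n: the n + 1 - k spots after it, up to n + 1, are all taken.
  let k := Nat.findGreatest (fun k => ∀ j, spot j ≠ k) n
  obtain ⟨k₀, hk₀n, hk₀⟩ := hfree
  have hk : ∀ j, spot j ≠ k := Nat.findGreatest_spec (P := fun k => ∀ j, spot j ≠ k) hk₀n hk₀
  have hkn : k ≤ n := Nat.findGreatest_le n
  have hocc : ∀ s, k < s → s ≤ n + 1 → ∃ j, spot j = s := by
    intro s hs hsn
    rcases hsn.lt_or_eq with hlt | rfl
    · have := Nat.findGreatest_is_greatest (P := fun k => ∀ j, spot j ≠ k) hs (by omega)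
      push Not at this
      exact this
    · exact hfull _ (by have := hpref i; omega) le_rfl
  refine ⟨k, hkn, ?_⟩
  have hsub : Finset.Ioc k (n + 1) ⊆ (Finset.univ.filter fun i => k < pref i).image spot := by
    intro s hs
    rw [Finset.mem_Ioc] at hs
    obtain ⟨j, rfl⟩ := hocc s hs.1 hs.2
    refine Finset.mem_image_of_mem _ (Finset.mem_filter.2 ⟨Finset.mem_univ _, ?_⟩)
    -- A car preferring a spot up to k would not have driven past the free spot k.
    by_contra! hc
    exact absurd ((h j).2 ⟨hc, fun l _ => hk l⟩) (by omega)
  have := (Finset.card_le_card hsub).trans Finset.card_image_le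
  rw [Nat.card_Ioc] at this
  omega

theorem mem_parkingFunctions_iff {m n : ℕ} {pref : Fin m → ℕ} :
    pref ∈ ParkingFunctions m n ↔ (∀ i, 1 ≤ pref i ∧ pref i ≤ n) ∧
      ∀ k ≤ n, (Finset.univ.filter fun i => k < pref i).card ≤ n - k := by
  refine and_congr_right fun hpref => ⟨?_, fun hc => ?_⟩
  · rintro ⟨spot, h, hn⟩ k -
    exact h.card_lt_pref_le hn k
  · obtain ⟨spot, h⟩ := exists_parksAt pref
    refine ⟨spot, h, fun i => ?_⟩
    by_contra! hi
    obtain ⟨k, hk, hlt⟩ := h.exists_lt_card hpref hi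
    exact absurd (hc k hk) (by omega)

/-! ### Labels sorted by preference -/

/-- The pair `(π_i, i)`, for the lexicographic order. -/
def prefKey {m : ℕ} (pref : Fin m → ℕ) (i : Fin m) : ℕ ×ₗ Fin m :=
  toLex (pref i, i)

theorem prefKey_injective {m : ℕ} (pref : Fin m → ℕ) : Function.Injective (prefKey pref) :=
  fun _ _ h => congrArg Prod.snd (toLex.injective h)

theorem orderPerm_eq_card {m : ℕ} (pref : Fin m → ℕ) (i : Fin m) :
    orderPerm pref i = (Finset.univ.filter fun j => prefKey pref j ≤ prefKey pref i).card := by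
  simp only [orderPerm, prefKey, Prod.Lex.toLex_le_toLex]

/-- In the list of all labels sorted by preference and label, the place of `i` is
`orderPerm pref i`. -/
theorem idxOf_add_one_eq_orderPerm {m : ℕ} {pref : Fin m → ℕ} {N : List (Fin m)}
    (hmem : ∀ i, i ∈ N) (hN : N.Pairwise fun i j => prefKey pref i < prefKey pref j)
    (i : Fin m) : N.idxOf i + 1 = orderPerm pref i := by
  have hnd : N.Nodup := hN.imp fun h e => h.ne (congrArg _ e)
  have hi := List.idxOf_lt_length_of_mem (hmem i)
  have hmono : ∀ a b (ha : a < N.length) (hb : b < N.length),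
      prefKey pref N[a] ≤ prefKey pref N[b] ↔ a ≤ b := by
    intro a b ha hb
    refine ⟨fun h => ?_, fun h => ?_⟩
    · by_contra! hlt
      exact absurd (List.pairwise_iff_getElem.1 hN b a hb ha hlt) h.not_gt
    · rcases h.lt_or_eq with h | rfl
      · exact (List.pairwise_iff_getElem.1 hN a b ha hb h).le
      · exact le_rfl
  -- Keys increase along `N`, so the labels with key at most that of i form a prefix.
  have hset : (Finset.univ.filter fun j => prefKey pref j ≤ prefKey pref i) =
      (N.take (N.idxOf i + 1)).toFinset := by
    ext j
    have hj := List.idxOf_lt_length_of_mem (hmem j)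
    have h := hmono _ _ hj hi
    rw [List.getElem_idxOf, List.getElem_idxOf] at h
    rw [Finset.mem_filter, List.mem_toFinset, List.mem_take_iff_idxOf_lt (hmem j), h]
    simp
  rw [orderPerm_eq_card, hset, List.toFinset_card_of_nodup (hnd.sublist (List.take_sublist _ _)),
    List.length_take]
  omega

theorem exists_sorted_labels {m : ℕ} (pref : Fin m → ℕ) :
    ∃ N : List (Fin m), (∀ i, i ∈ N) ∧ N.length = m ∧
      N.Pairwise fun i j => prefKey pref i < prefKey pref j := by
  let e := fun i j => prefKey pref i ≤ prefKey pref j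
  have : Std.Total e := ⟨fun _ _ => le_total _ _⟩
  have : IsTrans (Fin m) e := ⟨fun _ _ _ => le_trans⟩
  refine ⟨(List.finRange m).insertionSort e, by simp, by simp, ?_⟩
  have hs := List.pairwise_insertionSort e (List.finRange m)
  have hnd : ((List.finRange m).insertionSort e).Nodup :=
    (List.perm_insertionSort e _).nodup_iff.2 (List.nodup_finRange m)
  exact (hs.and hnd).imp fun h => h.1.lt_of_ne fun he => h.2 (prefKey_injective pref he)

/-- Two complete lists of labels that are sorted by preference and label are equal. -/
theorem eq_of_pairwise_prefKey {m : ℕ} {pref : Fin m → ℕ} {N N' : List (Fin m)}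
    (hmem : ∀ i, i ∈ N) (hmem' : ∀ i, i ∈ N')
    (hN : N.Pairwise fun i j => prefKey pref i < prefKey pref j)
    (hN' : N'.Pairwise fun i j => prefKey pref i < prefKey pref j) : N = N' := by
  have hnd : N.Nodup := hN.imp fun h e => h.ne (congrArg _ e)
  have hnd' : N'.Nodup := hN'.imp fun h e => h.ne (congrArg _ e)
  refine ((List.perm_ext_iff_of_nodup hnd hnd').2 fun i => by simp [hmem, hmem']).eq_of_pairwise
    (fun a b _ _ h h' => absurd h h'.not_gt) hN hN'

/-! ### Bijectivity of `φ` -/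

namespace RootedForest

variable {m n : ℕ} (F : RootedForest m n)

/-- Stated for any list of vertices, to serve both the breadth first order and the candidate for it
in the surjectivity proof. -/
theorem pairwise_flatMap_childLabels {pref : Fin m → ℕ} {L : List (ForestVertex m n)}
    (hL : L.Pairwise fun v w => ∀ i j, F.parent i = v → F.parent j = w → pref i < pref j)
    (hp : ∀ i j, F.parent i = F.parent j → pref i = pref j) :
    (L.flatMap F.childLabels).Pairwise fun i j => prefKey pref i < prefKey pref j := by
  rw [List.pairwise_flatMap]
  constructor
  · intro v _
    refine (F.pairwise_childLabels v).imp_of_mem fun {i j} hi hj hij => ?_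
    rw [mem_childLabels] at hi hj
    exact Prod.Lex.toLex_lt_toLex.2 (Or.inr ⟨hp i j (hi.trans hj.symm), hij⟩)
  · refine hL.imp fun h i hi j hj => ?_
    rw [mem_childLabels] at hi hj
    exact Prod.Lex.toLex_lt_toLex.2 (Or.inl (h i j hi hj))

theorem pairwise_place : F.bfsOrder.Pairwise fun v w => F.place v < F.place w := by
  rw [List.pairwise_iff_getElem]
  intro i j hi hj hij
  rwa [place_getElem, place_getElem]

theorem pairwise_nonrootOrder (hmn : m ≤ n) :
    F.nonrootOrder.Pairwise fun i j => prefKey (bfsMap F) i < prefKey (bfsMap F) j := by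
  rw [nonrootOrder_eq_flatMap]
  apply pairwise_flatMap_childLabels
  · refine F.pairwise_place.imp ?_
    rintro _ _ h i j rfl rfl
    rw [F.bfsMap_apply hmn, F.bfsMap_apply hmn]
    omega
  · intro i j h
    rw [F.bfsMap_apply hmn, F.bfsMap_apply hmn, h]

theorem orderPerm_bfsMap (hmn : m ≤ n) : orderPerm (bfsMap F) = F.bfsPerm :=
  funext fun i =>
    (idxOf_add_one_eq_orderPerm F.mem_nonrootOrder (F.pairwise_nonrootOrder hmn) i).symm

theorem bfsMap_mem (hmn : m ≤ n) : bfsMap F ∈ ParkingFunctions m n := by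
  rw [mem_parkingFunctions_iff]
  refine ⟨fun i => ?_, fun k hk => ?_⟩
  · have := F.place_parent_lt_n hmn i
    rw [F.bfsMap_apply hmn]
    omega
  · have hcard : (Finset.Ioc k n).card = n - k := Nat.card_Ioc k n
    rw [← hcard]
    -- If π_i > k, the parent of i has zero-based place at least k, so i has one in k + 1, …, n.
    refine Finset.card_le_card_of_injOn (fun i => F.place (Sum.inr i)) (fun i hi => ?_)
      (F.place_injective.comp Sum.inr_injective).injOn
    have h₁ := F.place_parent_lt i
    have h₂ := F.place_lt hmn (Sum.inr i)
    simp only [Finset.coe_filter, Finset.mem_univ, true_and, Set.mem_ofPred_eq,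
      F.bfsMap_apply hmn] at hi
    simp only [Finset.coe_Ioc, Set.mem_Ioc]
    omega

theorem bfsMap_injective (hmn : m ≤ n) :
    Function.Injective (bfsMap : RootedForest m n → Fin m → ℕ) := by
  intro F G h
  have hN : F.nonrootOrder = G.nonrootOrder :=
    eq_of_pairwise_prefKey F.mem_nonrootOrder G.mem_nonrootOrder (F.pairwise_nonrootOrder hmn)
      (h ▸ G.pairwise_nonrootOrder hmn)
  have hL : F.bfsOrder = G.bfsOrder := by
    rw [bfsOrder_eq_append_map, bfsOrder_eq_append_map, hN]
  ext1
  funext i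
  have hi := congrFun h i
  rw [F.bfsMap_apply hmn, G.bfsMap_apply hmn, place, place, hL, Nat.add_right_cancel_iff,
    List.idxOf_inj (G.mem_bfsOrder _)] at hi
  exact hi

theorem exists_bfsMap_eq (hmn : m ≤ n) {pref : Fin m → ℕ} (hpref : pref ∈ ParkingFunctions m n) :
    ∃ F : RootedForest m n, bfsMap F = pref := by
  obtain ⟨hrange, hcount⟩ := mem_parkingFunctions_iff.1 hpref
  obtain ⟨N, hmem, hlen, hN⟩ := exists_sorted_labels pref
  have hNnd : N.Nodup := hN.imp fun h e => h.ne (congrArg _ e)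
  -- The intended breadth first order.
  let L : List (ForestVertex m n) := (List.finRange (n - m + 1)).map Sum.inl ++ N.map Sum.inr
  have hLlen : L.length = n + 1 := by simp [L, hlen]; omega
  have hLnd : L.Nodup := by
    refine List.Nodup.append ((List.nodup_finRange _).map Sum.inl_injective)
      (hNnd.map Sum.inr_injective) fun v hv hw => ?_
    obtain ⟨i, -, rfl⟩ := List.mem_map.1 hv
    simp at hw
  have hlt : ∀ i, pref i - 1 < L.length := fun i => by have := hrange i; omega
  let par : Fin m → ForestVertex m n := fun i => L[pref i - 1]'(hlt i)
  have hidx : ∀ i, L.idxOf (par i) = pref i - 1 := fun i => hLnd.idxOf_getElem _ (hlt i)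
  have hidx_inr : ∀ i, L.idxOf (Sum.inr i) = n - m + orderPerm pref i := by
    intro i
    have hi := List.idxOf_lt_length_of_mem (hmem i)
    have hi' : n - m + 1 + N.idxOf i < L.length := by rw [hLlen]; omega
    have : L[n - m + 1 + N.idxOf i] = Sum.inr i := by
      simp only [L]
      rw [List.getElem_append_right (by simp)]
      simp
    rw [← this, hLnd.idxOf_getElem, ← idxOf_add_one_eq_orderPerm hmem hN i]
    omega
  have hpar_lt : ∀ i, L.idxOf (par i) < L.idxOf (Sum.inr i) := by
    intro i
    rw [hidx, hidx_inr]
    -- At most n - π_i + 1 cars prefer a spot from π_i on. One of them is i, and all labels sorted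
    -- after i are among the others, so m - τ_π(i) ≤ n - π_i.
    have h₁ := hcount (pref i - 1) (by have := hrange i; omega)
    have h₂ : (Finset.univ.filter fun j => ¬ prefKey pref j ≤ prefKey pref i) ⊆
        (Finset.univ.filter fun j => pref i - 1 < pref j).erase i := by
      intro j hj
      rw [Finset.mem_filter, not_le] at hj
      have hle : pref i ≤ pref j := by
        rcases Prod.Lex.toLex_lt_toLex.1 hj.2 with h | h
        · exact h.le
        · exact h.1.le
      have := hrange i
      refine Finset.mem_erase.2 ⟨fun h => hj.2.ne (by rw [h]), Finset.mem_filter.2 ⟨hj.1, ?_⟩⟩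
      omega
    have h₃ := Finset.card_le_card h₂
    rw [Finset.card_erase_of_mem (Finset.mem_filter.2
      ⟨Finset.mem_univ i, by have := hrange i; omega⟩)] at h₃
    have h₄ := Finset.card_filter_add_card_filter_not (s := (Finset.univ : Finset (Fin m)))
      (fun j => prefKey pref j ≤ prefKey pref i)
    rw [← orderPerm_eq_card, Finset.card_univ, Fintype.card_fin] at h₄
    have := hrange i
    have := i.2
    omega
  have hacyc : ∀ a b, Relation.TransGen (fun a b => par a = Sum.inr b) a b →
      L.idxOf (Sum.inr b) < L.idxOf (Sum.inr a) := by
    intro a b hab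
    induction hab with
    | single h => exact h ▸ hpar_lt _
    | tail _ h ih => exact (h ▸ hpar_lt _).trans ih
  let F : RootedForest m n := ⟨par, fun i hi => (hacyc i i hi).false⟩
  have hLmem : ∀ i, par i ∈ L := fun i => List.getElem_mem _
  -- Both lists contain all labels and are strictly sorted by key.
  have hchildren : L.flatMap F.childLabels = N := by
    refine eq_of_pairwise_prefKey (pref := pref)
      (fun i => List.mem_flatMap.2 ⟨par i, hLmem i, F.mem_childLabels.2 rfl⟩) hmem ?_ hN
    have hinj : ∀ i j, pref i - 1 = pref j - 1 → pref i = pref j := fun i j h => by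
      have := hrange i
      have := hrange j
      omega
    apply pairwise_flatMap_childLabels
    · rw [List.pairwise_iff_getElem]
      intro a b ha hb hab i j hi hj
      have hi' : pref i - 1 = a := hLnd.getElem_inj_iff.1 hi
      have hj' : pref j - 1 = b := hLnd.getElem_inj_iff.1 hj
      omega
    · exact fun i j h => hinj i j (hLnd.getElem_inj_iff.1 h)
  have hLF : L = F.bfsOrder := by
    refine F.eq_bfsOrder hmn ?_ hLlen
    rw [flatMap_children_eq_map, hchildren]
    rfl
  refine ⟨F, funext fun i => ?_⟩
  have := hrange i
  rw [F.bfsMap_apply hmn, place, ← hLF, show F.parent i = par i from rfl, hidx]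
  omega

end RootedForest

/-! ### The theorem and equidistribution -/

theorem bijOn_bfsMap {m n : ℕ} (hmn : m ≤ n) :
    Set.BijOn (bfsMap : RootedForest m n → Fin m → ℕ) Set.univ (ParkingFunctions m n) :=
  ⟨fun F _ => F.bfsMap_mem hmn, (RootedForest.bfsMap_injective hmn).injOn, fun _ h =>
    (RootedForest.exists_bfsMap_eq hmn h).imp fun _ hF => ⟨Set.mem_univ _, hF⟩⟩

theorem parkingStat_bfsMap {m n : ℕ} (hmn : m ≤ n) (F : RootedForest m n) :
    parkingStat n (bfsMap F) = forestStat F := by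
  refine Prod.ext (funext fun i => ?_) (funext fun j => ?_)
  · have := F.prefCount_bfsMap hmn (F.parent i)
    rwa [← F.bfsMap_apply hmn] at this
  · have := F.prefCount_bfsMap hmn (Sum.inl j)
    rwa [F.place_inl] at this

theorem theorem3p1 (m n : ℕ) (hmn : m ≤ n) :
    -- `φ` is a bijection from `F(m, n)` onto `PF(m, n)`
    Set.BijOn (bfsMap : RootedForest m n → Fin m → ℕ) Set.univ (ParkingFunctions m n) ∧
    -- it matches the specifications and the order permutations
    (∀ F : RootedForest m n, parkingSpec n (bfsMap F) = F.spec ∧ orderPerm (bfsMap F) = F.bfsPerm) ∧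
    -- the multiplicity of `π_i` is the degree of the parent of vertex `i`
    (∀ (F : RootedForest m n) (i : Fin m),
      prefCount (bfsMap F) (bfsMap F i) = F.deg (F.parent i)) ∧
    -- the multiplicity of `j` in `1, …, n-m+1` is the degree of the root `0j`
    (∀ (F : RootedForest m n) (j : Fin (n - m + 1)),
      prefCount (bfsMap F) ((j : ℕ) + 1) = F.deg (Sum.inl j)) ∧
    -- hence the statistics are (jointly) equidistributed
    (∀ A : Set ((Fin m → ℕ) × (Fin (n - m + 1) → ℕ)),
      {pref ∈ ParkingFunctions m n | parkingStat n pref ∈ A}.ncard =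
        {F : RootedForest m n | forestStat F ∈ A}.ncard) := by
  have hstat := fun F : RootedForest m n => parkingStat_bfsMap hmn F
  refine ⟨bijOn_bfsMap hmn, fun F => ⟨F.parkingSpec_bfsMap hmn, F.orderPerm_bfsMap hmn⟩,
    fun F i => congrFun (congrArg Prod.fst (hstat F)) i,
    fun F j => congrFun (congrArg Prod.snd (hstat F)) j, fun A => ?_⟩
  have himage : {pref ∈ ParkingFunctions m n | parkingStat n pref ∈ A} =
      bfsMap '' {F : RootedForest m n | forestStat F ∈ A} := by
    ext pref
    constructor
    · rintro ⟨hpref, hA⟩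
      obtain ⟨F, rfl⟩ := RootedForest.exists_bfsMap_eq hmn hpref
      exact ⟨F, by rwa [hstat] at hA, rfl⟩
    · rintro ⟨F, hF, rfl⟩
      exact ⟨F.bfsMap_mem hmn, by rwa [hstat]⟩
  rw [himage, Set.ncard_image_of_injective _ (RootedForest.bfsMap_injective hmn)]
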